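/- For a finite group $G$ and a subset $S\subseteq G\setminus\{1\}$, let $\mathrm{Cay}(G,S)$ be the digraph with vertex set $G$ and arc set $\{(g,sg)\mid g\in G,\ s\in S\}$. For a positive integer $m$, the group $G$ has the $m$-DCI property if, for all $S,T\subseteq G\setminus\{1\}$ with $|S|=m$ and $\mathrm{Cay}(G,S)\cong\mathrm{Cay}(G,T)$ (as digraphs), there is $\sigma\in\mathrm{Aut}(G)$ with $S^\sigma=T$. Theorem. Let $n\ge 3$ be an integer, and let $\mathrm{Q}_{4n}=\langle a,b\mid a^{2n}=1,\ b^2=a^n,\ b^{-1}ab=a^{-1}\rangle$ be the generalized quaternion group of order $4n$. Suppose that $\mathrm{Q}_{4n}$ has the $m$-DCI property for some integer $m$ with $1\le m\le 2n-1$. Then $n$ is odd, and $n$ is not divisible by $p^2$ for any prime $p\le m-1$. -/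

import Mathlib

/-- The Cayley digraph `Cay(G, S)`: the vertices are the elements of `G` and the arcs are the pairs
`(g, s * g)` with `g ∈ G` and `s ∈ S`. -/
def cayleyDigraph {G : Type*} [Group G] (S : Set G) : Digraph G where
  Adj g h := ∃ s ∈ S, h = s * g

/-- Isomorphism of digraphs: a bijection of the vertices preserving arcs in both directions. -/
def DigraphIsomorphic {V W : Type*} (Γ : Digraph V) (Δ : Digraph W) : Prop :=
  Nonempty (Γ.Adj ≃r Δ.Adj)

/-- `S` (a subset not containing `1`) is a CI-subset of `G`, that is, `Cay(G, S)` is a CI-digraph: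
every `T ⊆ G` with `1 ∉ T` and `Cay(G, S) ≅ Cay(G, T)` is the image of `S` under an automorphism
of `G`. -/
def IsCISubset {G : Type*} [Group G] (S : Set G) : Prop :=
  1 ∉ S ∧ ∀ T : Set G, 1 ∉ T → DigraphIsomorphic (cayleyDigraph S) (cayleyDigraph T) →
    ∃ σ : G ≃* G, σ '' S = T

/-- `G` has the `m`-DCI property: all `m`-valent Cayley digraphs of `G` are CI-digraphs. -/
def HasDCIProperty (G : Type*) [Group G] (m : ℕ) : Prop :=
  ∀ S : Set G, 1 ∉ S → S.encard = m → IsCISubset S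

/-!
For a suitable connection set `S` of each size `m` in question, a set `T` is found with an
isomorphic Cayley digraph that is not the image of `S` under an automorphism. Automorphisms are
controlled through `QuaternionGroup.exists_mulEquiv_apply_a`: as `n ≥ 3`, they preserve the cyclic
subgroup `⟨a⟩` of order `2 * n`, and act on it by multiplying exponents.

*Even `n`.* The group has a second subgroup of index two, the subgroup
`⟨a ^ 2, b⟩` of elements of even index, where `b = xa 0`. For every `m` there is a digraph of valency
`m` that is a Cayley digraph of both subgroups, for `S ⊆ ⟨a⟩` and for some `T ⊈ ⟨a⟩`; since the
group is the union of two cosets of either subgroup, `Cay(G, S)` and `Cay(G, T)` both consist of two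
copies of this digraph (`QuaternionGroup.digraphIsomorphic_image_a`). With `n = 2 * N` and
`c = a ^ N`, of order four as `b` is:
* if `N` is odd, `c` is replaced by `b` in the decomposition of `⟨a⟩` as the product of `⟨c⟩` and
  the subgroup of odd order. As `b` inverts the latter, `S` has to be invariant under the
  automorphism of `⟨a⟩` that fixes `c` and inverts the elements of odd order;
* if `N` is even, the right cosets of `⟨c⟩` are matched with those of `⟨b⟩`. The part of `S` outside
  `⟨c⟩` is a union of cosets of `⟨c⟩`, symmetric because `⟨b⟩ a ^ i ⟨b⟩` contains `a ^ (-i)`.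

Either way the involution concerned has enough fixed points for all sizes to occur
(`exists_invariant_subset_card`).

*Odd `n` with `p ^ 2 ∣ n`.* Let `P` be the subgroup of order `p`, let `z` generate `P`, and let
`z = w ^ p` with `w` of order `p ^ 2`. The set `S` consists of `z`, of `r < p` elements of
`a ^ n P`, of the coset `w P`, and of cosets of `P` outside `⟨a⟩`. The permutation that inverts the
subgroup `⟨P, a ^ n⟩` within each of its cosets, about a fixed representative, preserves the cosets
of `P`, so it is an isomorphism onto the digraph in which the elements of `S` in `⟨P, a ^ n⟩` are
inverted and the other elements are kept
(`QuaternionGroup.digraphIsomorphic_cosetReflection`). An automorphism `a ↦ a ^ t` with the same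
effect would satisfy `t = -1` modulo `p` because of `z`, and `t = 1` modulo `p` because of `w P`.
-/

/-! ### Isomorphisms of Cayley digraphs -/

theorem DigraphIsomorphic.of_mul_inv_mem {G : Type*} [Group G] {S T : Set G} (φ : G → G)
    (hφ : Function.Bijective φ) (h : ∀ g g', φ g' * (φ g)⁻¹ ∈ T ↔ g' * g⁻¹ ∈ S) :
    DigraphIsomorphic (cayleyDigraph S) (cayleyDigraph T) := by
  have key : ∀ (U : Set G) (g g' : G), (cayleyDigraph U).Adj g g' ↔ g' * g⁻¹ ∈ U := by
    intro U g g'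
    constructor
    · rintro ⟨s, hs, rfl⟩
      simpa using hs
    · intro hs
      exact ⟨_, hs, by simp⟩
  exact ⟨⟨Equiv.ofBijective φ hφ, fun {g g'} => by
    rw [key, key]; exact h g g'⟩⟩

/-! ### Counting -/

/-- The preimage of `V` under a surjective homomorphism `A → B` has `|V| * |A| / |B|` elements. -/
theorem card_filter_mem_mul_card {A B : Type*} [AddGroup A] [AddGroup B] [Fintype A]
    [Fintype B] [DecidableEq B] (π : A →+ B) (hπ : Function.Surjective π) (V : Finset B) :
    (Finset.univ.filter fun x => π x ∈ V).card * Fintype.card B = V.card * Fintype.card A := by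
  have fib : ∀ b, (Finset.univ.filter fun x => π x = b).card
      = (Finset.univ.filter fun x => π x = 0).card := by
    intro b
    obtain ⟨y, rfl⟩ := hπ b
    refine Finset.card_bij' (fun x _ => x - y) (fun x _ => x + y) ?_ ?_ ?_ ?_ <;> simp +contextual
  have count : ∀ W : Finset B, (Finset.univ.filter fun x => π x ∈ W).card
      = W.card * (Finset.univ.filter fun x => π x = 0).card := by
    intro W
    rw [Finset.card_eq_sum_card_fiberwise (f := π) (t := W) (fun x hx => by simpa using hx)]
    rw [← smul_eq_mul, ← Finset.sum_const]
    refine Finset.sum_congr rfl fun b hb => ?_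
    rw [← fib b]
    congr 1
    ext x
    simp only [Finset.mem_filter, Finset.mem_univ, true_and]
    constructor
    · exact fun h => h.2
    · rintro rfl
      exact ⟨hb, rfl⟩
  have huniv := count Finset.univ
  simp only [Finset.mem_univ, Finset.filter_true, Finset.card_univ] at huniv
  rw [count V, huniv]
  ring

/-- A set invariant under an involution has invariant subsets of all sizes as soon as the involution
has a fixed point in it: the fixed point corrects the parity. -/
theorem exists_invariant_subset_card {α : Type*} [DecidableEq α] {τ : α → α}
    (hτ : Function.Involutive τ) (A : Finset α) (hA : ∀ x ∈ A, τ x ∈ A) {u : α} (hu : u ∈ A)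
    (hτu : τ u = u) {m : ℕ} (hm : m ≤ A.card) :
    ∃ B ⊆ A, (∀ x ∈ B, τ x ∈ B) ∧ B.card = m := by
  induction hc : A.card using Nat.strong_induction_on generalizing A with
  | _ c ih =>
    by_cases hfix : ∀ x ∈ A, τ x = x
    · obtain ⟨B, hB, hBm⟩ := Finset.exists_subset_card_eq hm
      exact ⟨B, hB, fun x hx => by rwa [hfix x (hB hx)], hBm⟩
    push Not at hfix
    obtain ⟨v, hv, hτv⟩ := hfix
    rcases hm.eq_or_lt with h | h
    · exact ⟨A, subset_rfl, hA, h.symm⟩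
    rcases (Nat.le_sub_one_of_lt h).eq_or_lt with h' | h'
    · refine ⟨A.erase u, A.erase_subset u, fun x hx => ?_, by rw [Finset.card_erase_of_mem hu, h']⟩
      rw [Finset.mem_erase] at hx ⊢
      exact ⟨fun e => hx.1 (by rw [← hτ x, e, hτu]), hA x hx.2⟩
    · have hcard : ((A.erase v).erase (τ v)).card = A.card - 1 - 1 := by
        rw [Finset.card_erase_of_mem (Finset.mem_erase.2 ⟨hτv, hA v hv⟩),
          Finset.card_erase_of_mem hv]
      obtain ⟨B, hB, hB'⟩ := ih _ (by omega) ((A.erase v).erase (τ v)) (fun x hx => by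
          simp only [Finset.mem_erase] at hx ⊢
          exact ⟨fun e => hx.2.1 (hτ.injective e), fun e => hx.1 (by rw [← e, hτ x]),
            hA x hx.2.2⟩)
        (by
          simp only [Finset.mem_erase]
          exact ⟨fun e => hτv (by rw [e, hτ v] at hτu; rw [← hτu]),
            fun e => hτv (by rw [← e, hτu]), hu⟩) (by omega) rfl
      exact ⟨B, hB.trans ((Finset.erase_subset _ _).trans (Finset.erase_subset _ _)), hB'⟩

/-! ### Automorphisms, indices and parity in the generalized quaternion group -/

namespace QuaternionGroup

variable {n : ℕ}

theorem inv_a (i : ZMod (2 * n)) : (a i)⁻¹ = a (-i) := rfl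

theorem inv_xa (i : ZMod (2 * n)) : (xa i)⁻¹ = xa ((n : ZMod (2 * n)) + i) := rfl

/-- For `n ≥ 3` the order `2 * n` of `a 1` differs from the order `4` of the elements `xa i`, so an
automorphism preserves the cyclic subgroup generated by `a 1`. -/
theorem exists_mulEquiv_apply_a (hn : 3 ≤ n) (σ : QuaternionGroup n ≃* QuaternionGroup n) :
    ∃ t : ZMod (2 * n), ∀ i, σ (a i) = a (t * i) := by
  have : NeZero n := ⟨by omega⟩
  have hord : orderOf (σ (a 1)) = 2 * n := by
    rw [MulEquiv.orderOf_eq, orderOf_a_one]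
  rcases hσ : σ (a 1) with t | t
  · refine ⟨t, fun i => ?_⟩
    have hpow : ∀ k : ℕ, (a t : QuaternionGroup n) ^ k = a (t * (k : ZMod (2 * n))) := by
      intro k
      induction k with
      | zero => simp
      | succ k ih => rw [pow_succ, ih, a_mul_a]; push_cast; ring_nf
    have hi : a i = (a 1 : QuaternionGroup n) ^ i.val := by
      rw [a_one_pow, ZMod.natCast_zmod_val]
    rw [hi, map_pow, hσ, hpow, ZMod.natCast_zmod_val]
  · rw [hσ, orderOf_xa] at hord
    omega

theorem encard_image_a_union_image_xa (X Y : Finset (ZMod (2 * n))) :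
    (a '' (X : Set (ZMod (2 * n))) ∪ xa '' (Y : Set (ZMod (2 * n)))).encard
      = ((X.card + Y.card : ℕ) : ℕ∞) := by
  rw [Set.encard_union_eq, Function.Injective.encard_image, Function.Injective.encard_image,
    Set.encard_coe_eq_coe_finsetCard, Set.encard_coe_eq_coe_finsetCard]
  · push_cast; rfl
  · exact fun _ _ => xa.inj
  · exact fun _ _ => a.inj
  · rw [Set.disjoint_left]
    rintro _ ⟨i, _, rfl⟩ ⟨j, _, h⟩
    cases h

/-- The exponent `i` of `a`, both for `a i` and for `xa i`. -/
def index : QuaternionGroup n → ZMod (2 * n)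
  | a i => i
  | xa i => i

/-- The exponent of `a` modulo `n`. Left multiplication by `xa 0` does not change it, so it labels
the right cosets of the cyclic subgroup `⟨xa 0⟩` of order four. -/
def indexModN (g : QuaternionGroup n) : ZMod n :=
  ZMod.castHom (Dvd.intro_left 2 rfl) (ZMod n) (index g)

theorem indexModN_xa_zero_mul (g : QuaternionGroup n) : indexModN (xa 0 * g) = indexModN g := by
  rcases g with i | i <;> simp [indexModN, index, -ZMod.castHom_apply]

theorem indexModN_xa_zero_pow_mul (l : ℕ) (g : QuaternionGroup n) :
    indexModN (xa 0 ^ l * g) = indexModN g := by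
  induction l with
  | zero => simp
  | succ l ih => rw [pow_succ', mul_assoc, indexModN_xa_zero_mul, ih]

theorem indexModN_mul_inv (g h : QuaternionGroup n) :
    indexModN (g * h⁻¹) = indexModN g - indexModN h ∨
      indexModN (g * h⁻¹) = -(indexModN g - indexModN h) := by
  rcases g with i | i <;> rcases h with j | j <;>
    simp [indexModN, index, inv_a, inv_xa, sub_eq_add_neg, -ZMod.castHom_apply]

/-- The parity of a residue modulo `2 * n`. -/
def residueParity : ZMod (2 * n) →+* ZMod 2 :=
  ZMod.castHom (Dvd.intro n rfl) (ZMod 2)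

theorem residueParity_eq_zero_or_one (i : ZMod (2 * n)) :
    residueParity i = 0 ∨ residueParity i = 1 := by
  generalize residueParity i = x
  revert x
  decide

/-- The parity of the exponent of `a`; for even `n` it is a homomorphism, with kernel the index-two
subgroup generated by `a 2` and `xa 0`. -/
def indexParity (g : QuaternionGroup n) : ZMod 2 :=
  residueParity (index g)

theorem indexParity_mul (hn : Even n) (g h : QuaternionGroup n) :
    indexParity (g * h) = indexParity g + indexParity h := by
  have h0 : (n : ZMod 2) = 0 := (ZMod.natCast_eq_zero_iff_even).2 hn
  rcases g with i | i <;> rcases h with j | j <;>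
    simp [indexParity, residueParity, index, -ZMod.castHom_apply, sub_eq_add_neg, h0, add_comm]

theorem indexParity_inv (hn : Even n) (g : QuaternionGroup n) :
    indexParity g⁻¹ = indexParity g := by
  have h0 : (n : ZMod 2) = 0 := (ZMod.natCast_eq_zero_iff_even).2 hn
  rcases g with i | i <;>
    simp [indexParity, residueParity, index, inv_a, inv_xa, -ZMod.castHom_apply, h0]

/-- A bijection `f` from the cyclic subgroup generated by `a 1` to the subgroup of elements of even
index which matches `X` with `T` extends to the whole group: the other coset `{xa i}` of the cyclic
subgroup, consisting of the products `a (-i) * xa 0`, goes to the other coset of the subgroup of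
even index by `xa i ↦ f (-i) * a 1`. -/
theorem digraphIsomorphic_image_a [NeZero n] (hn : Even n) {f : ZMod (2 * n) → QuaternionGroup n}
    (hf : Function.Injective f) (hpar : ∀ i, indexParity (f i) = 0) {X : Set (ZMod (2 * n))}
    {T : Set (QuaternionGroup n)} (hT : ∀ g ∈ T, indexParity g = 0)
    (h : ∀ i j, f j * (f i)⁻¹ ∈ T ↔ j - i ∈ X) :
    DigraphIsomorphic (cayleyDigraph (a '' X)) (cayleyDigraph T) := by
  have ha1 : indexParity (a 1 : QuaternionGroup n) = 1 := by
    simp [indexParity, residueParity, index, -ZMod.castHom_apply]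
  have hmem : ∀ i : ZMod (2 * n), a i ∈ a '' X ↔ i ∈ X := fun i =>
    Function.Injective.mem_set_image fun _ _ => a.inj
  have hmem' : ∀ i : ZMod (2 * n), xa i ∉ a '' X := by
    rintro i ⟨j, _, hj⟩
    cases hj
  let φ : QuaternionGroup n → QuaternionGroup n
    | a i => f i
    | xa i => f (-i) * a 1
  have hinj : Function.Injective φ := by
    rintro (i | i) (j | j) hij
    · exact congrArg a (hf hij)
    · have := congrArg indexParity hij
      simp [φ, indexParity_mul hn, hpar, ha1] at this
    · have := congrArg indexParity hij
      simp [φ, indexParity_mul hn, hpar, ha1] at this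
    · exact congrArg xa (neg_injective (hf (mul_right_cancel hij)))
  refine DigraphIsomorphic.of_mul_inv_mem φ (Finite.injective_iff_bijective.1 hinj) ?_
  rintro (i | i) (j | j)
  · rw [inv_a, a_mul_a, hmem, ← sub_eq_add_neg]
    exact h i j
  · rw [inv_a, xa_mul_a]
    refine iff_of_false (fun hmemT => ?_) (hmem' _)
    have := hT _ hmemT
    simp [φ, indexParity_mul hn, indexParity_inv hn, hpar, ha1] at this
  · rw [inv_xa, a_mul_xa]
    refine iff_of_false (fun hmemT => ?_) (hmem' _)
    have := hT _ hmemT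
    simp [φ, indexParity_mul hn, indexParity_inv hn, hpar, ha1] at this
  · rw [inv_xa, xa_mul_xa, hmem]
    have hd : (n : ZMod (2 * n)) + (n + i) - j = -j - -i := by
      have : (2 * n : ZMod (2 * n)) = 0 := by exact_mod_cast ZMod.natCast_self (2 * n)
      linear_combination this
    rw [hd, ← h]
    simp [φ, mul_assoc]

/-! ### Even `n`: twins of Cayley digraphs of the cyclic subgroup -/

/-- The connection set `a '' X` lies in the characteristic cyclic subgroup, while `T` does not. -/
theorem not_hasDCIProperty_of_cyclic_twin (hn : 3 ≤ n) (heven : Even n)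
    {f : ZMod (2 * n) → QuaternionGroup n}
    (hf : Function.Injective f) (hpar : ∀ i, indexParity (f i) = 0) {X : Finset (ZMod (2 * n))}
    (hX : (0 : ZMod (2 * n)) ∉ X) {T : Set (QuaternionGroup n)} (hT : ∀ g ∈ T, indexParity g = 0)
    (h : ∀ i j, f j * (f i)⁻¹ ∈ T ↔ j - i ∈ X) {y : ZMod (2 * n)} (hy : xa y ∈ T) :
    ¬ HasDCIProperty (QuaternionGroup n) X.card := by
  have : NeZero n := ⟨by omega⟩
  intro hDCI
  have hcard : (a '' (X : Set (ZMod (2 * n)))).encard = (X.card : ℕ∞) := by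
    rw [Function.Injective.encard_image fun _ _ => a.inj, Set.encard_coe_eq_coe_finsetCard]
  have h1 : (1 : QuaternionGroup n) ∉ a '' (X : Set (ZMod (2 * n))) := by
    rintro ⟨i, hi, hi1⟩
    rw [one_def] at hi1
    exact hX (a.inj hi1 ▸ hi)
  have h1T : (1 : QuaternionGroup n) ∉ T := fun hmem => hX (by
    simpa using (h 0 0).1 (by simpa using hmem))
  obtain ⟨σ, hσ⟩ := (hDCI _ h1 hcard).2 T h1T
    (digraphIsomorphic_image_a heven hf hpar hT fun i j => (h i j).trans Finset.mem_coe.symm)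
  obtain ⟨t, ht⟩ := exists_mulEquiv_apply_a hn σ
  rw [← hσ] at hy
  obtain ⟨_, ⟨i, _, rfl⟩, hi⟩ := hy
  rw [ht] at hi
  cases hi

/-! ### The case `n = 2 * N` with `N` odd -/

section OddHalf

variable {N : ℕ}

/-- For odd `N`, write `a i` with `i` odd as `c * a (i - N)` with `c = a N` of order four, and
replace `c` by `xa 0`. This identifies the cyclic subgroup generated by `a 1` with the subgroup of
elements of even index. -/
def oddHalfTwin (i : ZMod (2 * (2 * N))) : QuaternionGroup (2 * N) :=
  if residueParity i = 0 then a i else xa (i - (N : ZMod (2 * (2 * N))))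

/-- The automorphism of `ZMod (4 * N)`, `N` odd, which fixes `N` and inverts the elements of odd
order. -/
def oddHalfInvolution (i : ZMod (2 * (2 * N))) : ZMod (2 * (2 * N)) :=
  if residueParity i = 0 then -i else ((2 * N : ℕ) : ZMod (2 * (2 * N))) - i

theorem residueParity_natCast_odd (hN : Odd N) :
    residueParity (N : ZMod (2 * (2 * N))) = 1 := by
  rw [map_natCast]
  exact (ZMod.natCast_eq_one_iff_odd).2 hN

theorem residueParity_oddHalfInvolution (i : ZMod (2 * (2 * N))) :
    residueParity (oddHalfInvolution i) = residueParity i := by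
  have h2 : (2 : ZMod 2) = 0 := rfl
  unfold oddHalfInvolution
  split_ifs with h
  · simp [h]
  · have h1 := (residueParity_eq_zero_or_one i).resolve_left h
    rw [map_sub, h1, map_natCast]
    push_cast
    rw [h2, zero_mul]
    rfl

theorem oddHalfInvolution_involutive :
    Function.Involutive (oddHalfInvolution : ZMod (2 * (2 * N)) → ZMod (2 * (2 * N))) := by
  intro i
  have hpar := residueParity_oddHalfInvolution i
  by_cases h : residueParity i = 0
  · rw [oddHalfInvolution, if_pos (hpar.trans h), oddHalfInvolution, if_pos h, neg_neg]
  · rw [oddHalfInvolution, if_neg (by rwa [hpar]), oddHalfInvolution, if_neg h, sub_sub_cancel]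

theorem indexParity_oddHalfTwin (hN : Odd N) (i : ZMod (2 * (2 * N))) :
    indexParity (oddHalfTwin i) = 0 := by
  unfold oddHalfTwin
  split_ifs with h
  · exact h
  · change residueParity (i - (N : ZMod (2 * (2 * N)))) = 0
    rw [map_sub, residueParity_natCast_odd hN,
      (residueParity_eq_zero_or_one i).resolve_left h, sub_self]

theorem oddHalfTwin_injective :
    Function.Injective (oddHalfTwin : ZMod (2 * (2 * N)) → QuaternionGroup (2 * N)) := by
  intro i j hij
  unfold oddHalfTwin at hij
  split_ifs at hij
  · exact a.inj hij
  · exact sub_left_injective (xa.inj hij)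

/-- Since conjugation by `xa 0` inverts the elements of odd order, twins are compatible with
differences only up to `oddHalfInvolution`; a connection set invariant under this involution is
therefore matched with its twin. -/
theorem oddHalfTwin_mul_inv (i j : ZMod (2 * (2 * N))) :
    oddHalfTwin j * (oddHalfTwin i)⁻¹
      = oddHalfTwin (if residueParity i = 0 then j - i else oddHalfInvolution (j - i)) := by
  have h4 : (2 * (2 * N) : ZMod (2 * (2 * N))) = 0 := by
    exact_mod_cast ZMod.natCast_self (2 * (2 * N))
  have h10 : (1 : ZMod 2) ≠ 0 := by decide
  have hinv := residueParity_oddHalfInvolution (j - i)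
  rcases residueParity_eq_zero_or_one i with hi | hi <;>
    rcases residueParity_eq_zero_or_one j with hj | hj
  · have hji : residueParity (j - i) = 0 := by rw [map_sub, hi, hj, sub_self]
    rw [if_pos hi, oddHalfTwin, if_pos hj, oddHalfTwin, if_pos hi, oddHalfTwin, if_pos hji, inv_a,
      a_mul_a, ← sub_eq_add_neg]
  · have hji : residueParity (j - i) ≠ 0 := by rw [map_sub, hi, hj, sub_zero]; exact h10
    rw [if_pos hi, oddHalfTwin, if_neg (by rw [hj]; exact h10), oddHalfTwin, if_pos hi, oddHalfTwin,
      if_neg hji, inv_a, xa_mul_a]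
    congr 1
    ring
  · have hji : residueParity (j - i) ≠ 0 := by rw [map_sub, hi, hj]; decide
    have hi' : residueParity i ≠ 0 := by rw [hi]; exact h10
    rw [if_neg hi', oddHalfTwin, if_pos hj, oddHalfTwin, if_neg hi', oddHalfTwin,
      if_neg (by rwa [hinv]), oddHalfInvolution, if_neg hji, inv_xa, a_mul_xa]
    congr 1
    ring
  · have hji : residueParity (j - i) = 0 := by rw [map_sub, hi, hj, sub_self]
    have hi' : residueParity i ≠ 0 := by rw [hi]; exact h10
    rw [if_neg hi', oddHalfTwin, if_neg (by rw [hj]; exact h10), oddHalfTwin, if_neg hi',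
      oddHalfTwin, if_pos (by rw [hinv, hji]), oddHalfInvolution, if_pos hji, inv_xa, xa_mul_xa]
    congr 1
    push_cast
    linear_combination h4

theorem not_hasDCIProperty_of_odd_half (hN : Odd N) (hN3 : 3 ≤ N) {m : ℕ} (hm₁ : 1 ≤ m)
    (hm₂ : m ≤ 2 * (2 * N) - 1) : ¬ HasDCIProperty (QuaternionGroup (2 * N)) m := by
  have : NeZero N := ⟨by omega⟩
  have h4 : (2 * (2 * N) : ZMod (2 * (2 * N))) = 0 := by
    exact_mod_cast ZMod.natCast_self (2 * (2 * N))
  have hNpar := residueParity_natCast_odd hN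
  have hNpar' : residueParity (N : ZMod (2 * (2 * N))) ≠ 0 := by rw [hNpar]; decide
  have hNfix : oddHalfInvolution (N : ZMod (2 * (2 * N))) = N := by
    rw [oddHalfInvolution, if_neg hNpar']
    push_cast
    ring
  have h2par : residueParity ((2 * N : ℕ) : ZMod (2 * (2 * N))) = 0 := by
    rw [map_natCast, ZMod.natCast_eq_zero_iff_even]
    exact even_two_mul N
  have h2fix : oddHalfInvolution ((2 * N : ℕ) : ZMod (2 * (2 * N))) = (2 * N : ℕ) := by
    rw [oddHalfInvolution, if_pos h2par]
    push_cast
    linear_combination -h4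
  have h0fix : oddHalfInvolution (0 : ZMod (2 * (2 * N))) = 0 := by simp [oddHalfInvolution]
  have hinj := (oddHalfInvolution_involutive (N := N)).injective
  have hN0 : (N : ZMod (2 * (2 * N))) ≠ 0 := fun h => hNpar' (by rw [h, map_zero])
  have h20 : ((2 * N : ℕ) : ZMod (2 * (2 * N))) ≠ 0 := by
    rw [Ne, ZMod.natCast_eq_zero_iff]
    exact fun h => by have := Nat.le_of_dvd (by omega) h; omega
  -- the fixed point `N` is put into `X` because its twin `xa 0` lies outside the cyclic subgroup;
  -- the fixed point `2 * N` makes all sizes of the rest of `X` possible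
  obtain ⟨B, hBA, hB, hBcard⟩ := exists_invariant_subset_card (u := ((2 * N : ℕ) : ZMod _))
    oddHalfInvolution_involutive
    (((Finset.univ : Finset (ZMod (2 * (2 * N)))).erase 0).erase (N : ZMod (2 * (2 * N))))
    (fun x hx => by
      simp only [Finset.mem_erase, Finset.mem_univ, and_true] at hx ⊢
      exact ⟨fun e => hx.1 (hinj (e.trans hNfix.symm)),
        fun e => hx.2 (hinj (e.trans h0fix.symm))⟩)
    (by
      simp only [Finset.mem_erase, Finset.mem_univ, and_true]
      exact ⟨fun e => hNpar' (by rw [← e, h2par]), h20⟩)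
    h2fix (m := m - 1) (by
      rw [Finset.card_erase_of_mem (by simpa using hN0), Finset.card_erase_of_mem (by simp),
        Finset.card_univ, ZMod.card]
      omega)
  have hNB : (N : ZMod (2 * (2 * N))) ∉ B := fun h => by simpa using hBA h
  have hXinv : ∀ x, oddHalfInvolution x ∈ insert (N : ZMod (2 * (2 * N))) B ↔
      x ∈ insert (N : ZMod (2 * (2 * N))) B := by
    have hfwd : ∀ x ∈ insert (N : ZMod (2 * (2 * N))) B,
        oddHalfInvolution x ∈ insert (N : ZMod (2 * (2 * N))) B := by
      intro x hx
      rcases Finset.mem_insert.1 hx with rfl | hx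
      · rw [hNfix]
        exact Finset.mem_insert_self _ _
      · exact Finset.mem_insert_of_mem (hB x hx)
    exact fun x => ⟨fun hx => by simpa [oddHalfInvolution_involutive x] using hfwd _ hx, hfwd x⟩
  have hcard : (insert (N : ZMod (2 * (2 * N))) B).card = m := by
    rw [Finset.card_insert_of_notMem hNB, hBcard]
    omega
  rw [← hcard]
  refine not_hasDCIProperty_of_cyclic_twin (by omega) (even_two_mul N) oddHalfTwin_injective
    (indexParity_oddHalfTwin hN) ?_
    (T := oddHalfTwin '' (insert (N : ZMod (2 * (2 * N))) B : Finset (ZMod (2 * (2 * N))))) ?_ ?_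
    (y := 0) ?_
  · rw [Finset.mem_insert, not_or]
    exact ⟨hN0.symm, fun h => by simpa using hBA h⟩
  · rintro _ ⟨i, _, rfl⟩
    exact indexParity_oddHalfTwin hN i
  · intro i j
    rw [oddHalfTwin_mul_inv, oddHalfTwin_injective.mem_set_image, Finset.mem_coe]
    split_ifs
    · rfl
    · exact hXinv _
  · refine ⟨N, by simp, ?_⟩
    rw [oddHalfTwin, if_neg hNpar', sub_self]

end OddHalf

/-! ### The case `n = 2 * N` with `N` even -/

section EvenHalf

variable {N : ℕ}

/-- Write `i = q * N + r` with `r < N`, so that `a i = (a N) ^ q * a r` where `a N` has order four.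
The twin of `a i` is `(xa 0) ^ q * a (2 * r)`: right cosets of `⟨a N⟩` in the cyclic subgroup
are sent to right cosets of `⟨xa 0⟩` in the subgroup of elements of even index. -/
def evenHalfTwin (i : ZMod (2 * (2 * N))) : QuaternionGroup (2 * N) :=
  xa 0 ^ (i.val / N) * a ((2 * (i.val % N) : ℕ) : ZMod (2 * (2 * N)))

/-- Reduction modulo `N`, whose fibres are the cosets of the subgroup of order four. -/
def modHalf : ZMod (2 * (2 * N)) →+* ZMod N :=
  ZMod.castHom (Dvd.intro_left 4 (by ring)) (ZMod N)

theorem modHalf_surjective :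
    Function.Surjective (modHalf : ZMod (2 * (2 * N)) →+* ZMod N) :=
  ZMod.castHom_surjective _

theorem evenHalfTwin_add [NeZero N] (i : ZMod (2 * (2 * N))) :
    evenHalfTwin (i + (N : ZMod (2 * (2 * N)))) = xa 0 * evenHalfTwin i := by
  have hN : 0 < N := NeZero.pos N
  have hval : (i + (N : ZMod (2 * (2 * N)))).val = (i.val + N) % (4 * N) := by
    rw [ZMod.val_add, ZMod.val_natCast, Nat.mod_eq_of_lt (a := N) (by omega)]
    congr 1
    ring
  have hdiv : (i + (N : ZMod (2 * (2 * N)))).val / N ≡ i.val / N + 1 [MOD 4] := by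
    rw [hval, Nat.mod_mul_left_div_self, Nat.add_div_right _ hN]
    exact Nat.mod_modEq _ _
  have hmod : (i + (N : ZMod (2 * (2 * N)))).val % N = i.val % N := by
    rw [hval, Nat.mod_mul_left_mod, Nat.add_mod_right]
  have hpow : (xa 0 : QuaternionGroup (2 * N)) ^ ((i + (N : ZMod (2 * (2 * N)))).val / N)
      = xa 0 ^ (i.val / N + 1) := by
    rw [pow_eq_pow_iff_modEq, orderOf_xa]
    exact hdiv
  rw [evenHalfTwin, hpow, hmod, pow_succ', mul_assoc, ← evenHalfTwin]

theorem evenHalfTwin_add_mul [NeZero N] (i : ZMod (2 * (2 * N))) (l : ℕ) :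
    evenHalfTwin (i + (l : ZMod (2 * (2 * N))) * (N : ZMod (2 * (2 * N))))
      = xa 0 ^ l * evenHalfTwin i := by
  induction l with
  | zero => simp
  | succ l ih =>
    rw [pow_succ', mul_assoc, ← ih, ← evenHalfTwin_add]
    congr 1
    push_cast
    ring

theorem exists_eq_mul_of_modHalf_eq_zero [NeZero N] {i : ZMod (2 * (2 * N))}
    (hi : modHalf i = 0) :
    ∃ l : ℕ, l < 4 ∧ i = (l : ZMod (2 * (2 * N))) * (N : ZMod (2 * (2 * N))) := by
  have hdvd : N ∣ i.val := by
    rw [← ZMod.natCast_zmod_val i, map_natCast, ZMod.natCast_eq_zero_iff] at hi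
    exact hi
  obtain ⟨l, hl⟩ := hdvd
  refine ⟨l, ?_, ?_⟩
  · have := ZMod.val_lt i
    rw [hl] at this
    by_contra! h
    have := Nat.mul_le_mul_left N h
    omega
  · rw [← ZMod.natCast_zmod_val i, hl]
    push_cast
    ring

/-- Twice a residue, as a residue modulo `2 * N`. -/
def doubleResidue : ZMod (2 * (2 * N)) →+ ZMod (2 * N) :=
  (AddMonoidHom.mulLeft 2).comp
    (ZMod.castHom (Dvd.intro_left 2 rfl) (ZMod (2 * N))).toAddMonoidHom

theorem doubleResidue_eq_zero_iff [NeZero N] (i : ZMod (2 * (2 * N))) :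
    doubleResidue i = 0 ↔ modHalf i = 0 := by
  have h : doubleResidue i = ((2 * i.val : ℕ) : ZMod (2 * N)) := by
    conv_lhs => rw [← ZMod.natCast_zmod_val i]
    simp [doubleResidue, -ZMod.castHom_apply, -ZMod.natCast_val]
  have h' : modHalf i = ((i.val : ℕ) : ZMod N) := by
    conv_lhs => rw [← ZMod.natCast_zmod_val i]
    rw [map_natCast]
  rw [h, h', ZMod.natCast_eq_zero_iff, ZMod.natCast_eq_zero_iff,
    Nat.mul_dvd_mul_iff_left two_pos]

theorem doubleResidue_eq_iff [NeZero N] (i j : ZMod (2 * (2 * N))) :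
    doubleResidue i = doubleResidue j ↔ modHalf i = modHalf j := by
  rw [← sub_eq_zero, ← map_sub, doubleResidue_eq_zero_iff, map_sub, sub_eq_zero]

/-- The fibre of `modHalf` over `i` is sent to a fibre of the index modulo `n`. -/
theorem indexModN_evenHalfTwin [NeZero N] (i : ZMod (2 * (2 * N))) :
    indexModN (evenHalfTwin i) = doubleResidue i := by
  have h : indexModN (evenHalfTwin i) = doubleResidue ((i.val % N : ℕ) : ZMod (2 * (2 * N))) := by
    rw [evenHalfTwin, indexModN_xa_zero_pow_mul]
    simp only [indexModN, index, doubleResidue, AddMonoidHom.comp_apply, AddMonoidHom.coe_mulLeft]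
    exact (congrArg _ (Nat.cast_mul 2 _)).trans (by rw [map_mul, Nat.cast_ofNat, map_ofNat]; rfl)
  rw [h, doubleResidue_eq_iff]
  conv_rhs => rw [← ZMod.natCast_zmod_val i]
  rw [map_natCast, map_natCast, ZMod.natCast_mod]

theorem evenHalfTwin_injective [NeZero N] :
    Function.Injective (evenHalfTwin : ZMod (2 * (2 * N)) → QuaternionGroup (2 * N)) := by
  intro i j hij
  have hmod : modHalf (j - i) = 0 := by
    rw [map_sub, sub_eq_zero, ← doubleResidue_eq_iff, ← indexModN_evenHalfTwin,
      ← indexModN_evenHalfTwin, hij]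
  obtain ⟨l, hl, hji⟩ := exists_eq_mul_of_modHalf_eq_zero hmod
  have hj : j = i + (l : ZMod (2 * (2 * N))) * (N : ZMod (2 * (2 * N))) := by rw [← hji]; ring
  rw [hj, evenHalfTwin_add_mul, right_eq_mul, ← orderOf_dvd_iff_pow_eq_one, orderOf_xa] at hij
  rw [hj, Nat.eq_zero_of_dvd_of_lt hij hl]
  simp

theorem indexParity_eq_zero_of_indexModN {g : QuaternionGroup (2 * N)} {v : ZMod (2 * (2 * N))}
    (h : indexModN g = doubleResidue v) : indexParity g = 0 := by
  have h2 : (2 : ZMod 2) = 0 := rfl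
  have hcomp : indexParity g = ZMod.castHom (Dvd.intro N rfl) (ZMod 2) (indexModN g) := by
    unfold indexParity residueParity indexModN
    rw [← RingHom.comp_apply, RingHom.ext_zmod (RingHom.comp _ _) (ZMod.castHom _ (ZMod 2))]
  rw [hcomp, h]
  simp only [doubleResidue, AddMonoidHom.comp_apply, AddMonoidHom.coe_mulLeft, map_mul,
    map_ofNat, h2, zero_mul]

theorem not_hasDCIProperty_of_even_half (hN : Even N) (hN2 : 2 ≤ N) {m : ℕ} (hm₁ : 1 ≤ m)
    (hm₂ : m ≤ 2 * (2 * N) - 1) : ¬ HasDCIProperty (QuaternionGroup (2 * N)) m := by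
  have : NeZero N := ⟨by omega⟩
  obtain ⟨u, hu⟩ := hN
  have hu0 : (u : ZMod N) ≠ 0 := by
    rw [Ne, ZMod.natCast_eq_zero_iff]
    exact fun h => by have := Nat.le_of_dvd (by omega) h; omega
  -- negation fixes `N / 2 ≠ 0` in `ZMod N`, so symmetric sets of nonzero residues have all sizes
  obtain ⟨V, hV0, hVneg, hVcard⟩ := exists_invariant_subset_card (τ := fun x : ZMod N => -x)
    neg_involutive (Finset.univ.erase 0) (fun x hx => by simpa using hx) (u := (u : ZMod N))
    (by simpa using hu0) (by
      have : (u : ZMod N) + u = 0 := by rw [← Nat.cast_add, ← hu, ZMod.natCast_self]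
      linear_combination -this) (m := m / 4) (by
      rw [Finset.card_erase_of_mem (Finset.mem_univ _), Finset.card_univ, ZMod.card]
      omega)
  have h0V : (0 : ZMod N) ∉ V := fun h => by simpa using hV0 h
  have hinjl : ∀ l : ℕ, l < 4 → ∀ l' : ℕ, l' < 4 →
      (l : ZMod (2 * (2 * N))) * (N : ZMod (2 * (2 * N)))
        = (l' : ZMod (2 * (2 * N))) * (N : ZMod (2 * (2 * N))) →
      l = l' := by
    intro l hl l' hl' h
    have h' : ((l * N : ℕ) : ZMod (2 * (2 * N))) = ((l' * N : ℕ) : ZMod (2 * (2 * N))) := by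
      push_cast
      exact h
    rw [ZMod.natCast_eq_natCast_iff'] at h'
    have hb : ∀ k < 4, k * N < 2 * (2 * N) := fun k hk => by
      have := Nat.mul_lt_mul_of_pos_right hk (by omega : 0 < N)
      omega
    rw [Nat.mod_eq_of_lt (hb l hl), Nat.mod_eq_of_lt (hb l' hl')] at h'
    exact Nat.eq_of_mul_eq_mul_right (by omega) h'
  have hmodl : ∀ l : ℕ, modHalf ((l : ZMod (2 * (2 * N))) * (N : ZMod (2 * (2 * N)))) = 0 := by
    intro l
    rw [map_mul, map_natCast, map_natCast, ZMod.natCast_self, mul_zero]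
  -- `X` consists of whole fibres over `V` and of `m % 4` nonzero elements of the fibre over `0`
  set X₀ : Finset (ZMod (2 * (2 * N))) :=
    (Finset.Icc 1 (m % 4)).image
      fun l : ℕ => (l : ZMod (2 * (2 * N))) * (N : ZMod (2 * (2 * N))) with hX₀
  set X₁ : Finset (ZMod (2 * (2 * N))) := Finset.univ.filter fun x => modHalf x ∈ V with hX₁
  have hX₀card : X₀.card = m % 4 := by
    rw [hX₀, Finset.card_image_of_injOn, Nat.card_Icc]
    · omega
    · intro l hl l' hl' h
      rw [Finset.coe_Icc, Set.mem_Icc] at hl hl'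
      exact hinjl l (by omega) l' (by omega) h
  have hX₁card : X₁.card = 4 * (m / 4) := by
    have := card_filter_mem_mul_card (modHalf (N := N)).toAddMonoidHom
      modHalf_surjective V
    rw [hVcard, ZMod.card, ZMod.card] at this
    refine Nat.eq_of_mul_eq_mul_right (by omega : 0 < N) (this.trans ?_)
    ring
  have hdisj : Disjoint X₁ X₀ := by
    rw [Finset.disjoint_left]
    intro x hx hx'
    obtain ⟨l, _, rfl⟩ := Finset.mem_image.1 hx'
    rw [hX₁, Finset.mem_filter, hmodl] at hx
    exact h0V hx.2
  have hcard : (X₁ ∪ X₀).card = m := by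
    rw [Finset.card_union_of_disjoint hdisj, hX₀card, hX₁card]
    omega
  rw [← hcard]
  -- the index modulo `n` of a quotient of twins is determined only up to sign, whence `V = -V`
  have key : ∀ i j, evenHalfTwin j * (evenHalfTwin i)⁻¹ ∈
      {g : QuaternionGroup (2 * N) | (∃ v, modHalf v ∈ V ∧ indexModN g = doubleResidue v) ∨
        ∃ l ∈ Finset.Icc 1 (m % 4), g = xa 0 ^ l} ↔ j - i ∈ X₁ ∪ X₀ := by
    intro i j
    rw [Finset.mem_union, Set.mem_ofPred_eq]
    refine or_congr ?_ ?_
    · rw [hX₁, Finset.mem_filter, and_iff_right (Finset.mem_univ _)]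
      have hneg : ∀ x : ZMod N, -x ∈ V ↔ x ∈ V := fun x =>
        ⟨fun h => by simpa using hVneg _ h, hVneg x⟩
      rcases indexModN_mul_inv (evenHalfTwin j) (evenHalfTwin i) with h | h <;>
        rw [h, indexModN_evenHalfTwin, indexModN_evenHalfTwin, ← map_sub]
      · exact ⟨fun ⟨v, hv, hv'⟩ => by rwa [(doubleResidue_eq_iff _ _).1 hv'],
          fun h => ⟨_, h, rfl⟩⟩
      · rw [← map_neg]
        exact ⟨fun ⟨v, hv, hv'⟩ => by
            rwa [← (doubleResidue_eq_iff _ _).1 hv', map_neg, hneg] at hv,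
          fun h => ⟨_, by rwa [map_neg, hneg], rfl⟩⟩
    · -- inside one fibre, translation by `N` corresponds to left multiplication by `xa 0`
      rw [hX₀, Finset.mem_image]
      refine exists_congr fun l => and_congr_right fun _ => ?_
      rw [mul_inv_eq_iff_eq_mul, ← evenHalfTwin_add_mul, evenHalfTwin_injective.eq_iff,
        eq_sub_iff_add_eq', eq_comm]
  have hparb : indexParity (xa 0 : QuaternionGroup (2 * N)) = 0 := by
    simp [indexParity, residueParity, index]
  obtain ⟨y, hy⟩ : ∃ y, (xa y : QuaternionGroup (2 * N)) ∈
      {g : QuaternionGroup (2 * N) | (∃ v, modHalf v ∈ V ∧ indexModN g = doubleResidue v) ∨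
        ∃ l ∈ Finset.Icc 1 (m % 4), g = xa 0 ^ l} := by
    by_cases hr : m % 4 = 0
    · obtain ⟨v, hv⟩ : V.Nonempty := by
        rw [← Finset.card_pos, hVcard]
        omega
      obtain ⟨v, rfl⟩ := modHalf_surjective v
      refine ⟨2 * v, Or.inl ⟨v, hv, ?_⟩⟩
      exact (map_mul _ 2 v).trans (by rw [map_ofNat]; rfl)
    · exact ⟨0, Or.inr ⟨1, Finset.mem_Icc.2 ⟨le_rfl, by omega⟩, (pow_one _).symm⟩⟩
  refine not_hasDCIProperty_of_cyclic_twin (by omega) (even_two_mul N) evenHalfTwin_injective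
    (fun i => indexParity_eq_zero_of_indexModN (indexModN_evenHalfTwin i)) ?_ ?_ key hy
  · rw [Finset.mem_union, not_or]
    refine ⟨fun h => h0V ?_, fun h => ?_⟩
    · simpa [hX₁] using h
    · obtain ⟨l, hl, hl0⟩ := Finset.mem_image.1 h
      rw [Finset.mem_Icc] at hl
      have := hinjl l (by omega) 0 (by omega) (by rw [hl0]; simp)
      omega
  · rintro g (⟨v, -, hv⟩ | ⟨l, -, rfl⟩)
    · exact indexParity_eq_zero_of_indexModN hv
    · induction l with
      | zero => simp [indexParity, residueParity, index, one_def, -a_zero]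
      | succ l ih => rw [pow_succ, indexParity_mul (even_two_mul N), ih, hparb, add_zero]

end EvenHalf

/-! ### Square factors of odd `n` -/

section PrimeSquare

variable {n : ℕ}

theorem exists_eq_mul_of_castHom_eq_zero [NeZero n] {e : ℕ} (he : e ∣ n) {y : ZMod n}
    (hy : ZMod.castHom he (ZMod e) y = 0) : ∃ l : ZMod n, y = (e : ZMod n) * l := by
  rw [← ZMod.natCast_zmod_val y, map_natCast, ZMod.natCast_eq_zero_iff] at hy
  obtain ⟨l, hl⟩ := hy
  refine ⟨(l : ZMod n), ?_⟩
  rw [← ZMod.natCast_zmod_val y, hl, Nat.cast_mul]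

/-- The reflection of each coset of the subgroup `h * ZMod n` in its representative
between `0` and `h - 1`. -/
def cosetReflection {h : ℕ} (hh : h ∣ n) (i : ZMod n) : ZMod n :=
  2 * ((ZMod.castHom hh (ZMod h) i).val : ZMod n) - i

section cosetReflection

variable {h : ℕ} (hh : h ∣ n)

theorem cosetReflection_sub {i j : ZMod n} (hij : ZMod.castHom hh (ZMod h) (j - i) = 0) :
    cosetReflection hh j - cosetReflection hh i = -(j - i) := by
  rw [map_sub, sub_eq_zero] at hij
  rw [cosetReflection, cosetReflection, hij]
  ring

variable [NeZero h]

theorem castHom_cosetReflection (i : ZMod n) :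
    ZMod.castHom hh (ZMod h) (cosetReflection hh i) = ZMod.castHom hh (ZMod h) i := by
  unfold cosetReflection
  rw [map_sub, map_mul, map_natCast, ZMod.natCast_zmod_val, map_ofNat]
  ring

theorem cosetReflection_involutive : Function.Involutive (cosetReflection hh) := by
  intro i
  rw [cosetReflection, castHom_cosetReflection, cosetReflection, sub_sub_cancel]

theorem castHom_two_mul_cosetReflection [NeZero n] (hh2 : 2 * h ∣ n) (i : ZMod n) :
    ZMod.castHom hh2 (ZMod (2 * h)) (cosetReflection hh i)
      = ZMod.castHom hh2 (ZMod (2 * h)) i := by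
  have hker : ZMod.castHom hh (ZMod h) (((ZMod.castHom hh (ZMod h) i).val : ZMod n) - i) = 0 := by
    rw [map_sub, map_natCast, ZMod.natCast_zmod_val, sub_self]
  obtain ⟨l, hl⟩ := exists_eq_mul_of_castHom_eq_zero hh hker
  have hdiff : cosetReflection hh i - i = ((2 * h : ℕ) : ZMod n) * l := by
    rw [Nat.cast_mul, Nat.cast_ofNat, mul_assoc, ← hl, cosetReflection]
    ring
  rw [← sub_eq_zero, ← map_sub, hdiff, map_mul, map_natCast, ZMod.natCast_self, zero_mul]

end cosetReflection

/-- Reflecting the exponents in both cosets `{a i}` and `{xa i}` negates the differences lying in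
`h * ZMod (2 * n)`, and keeps all differences modulo `2 * h`. Hence it transports a connection set
made of elements of the first kind and of whole classes modulo `2 * h`. -/
theorem digraphIsomorphic_cosetReflection [NeZero n] {h : ℕ} [NeZero h] (hh : h ∣ 2 * n)
    (hh2 : 2 * h ∣ 2 * n) {M : Set (ZMod (2 * n))}
    (hM : ∀ x ∈ M, ZMod.castHom hh (ZMod h) x = 0) (W Y : Set (ZMod (2 * h))) :
    DigraphIsomorphic
      (cayleyDigraph (a '' {i | i ∈ M ∨ ZMod.castHom hh2 (ZMod (2 * h)) i ∈ W} ∪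
        xa '' {i | ZMod.castHom hh2 (ZMod (2 * h)) i ∈ Y} : Set (QuaternionGroup n)))
      (cayleyDigraph (a '' {i | -i ∈ M ∨ ZMod.castHom hh2 (ZMod (2 * h)) i ∈ W} ∪
        xa '' {i | ZMod.castHom hh2 (ZMod (2 * h)) i ∈ Y} : Set (QuaternionGroup n))) := by
  have hn2 : (n : ZMod (2 * n)) + n = 0 := by
    rw [← two_mul]
    exact_mod_cast ZMod.natCast_self (2 * n)
  have memA : ∀ (X Y : Set (ZMod (2 * n))) i, a i ∈ a '' X ∪ xa '' Y ↔ i ∈ X := fun X Y i => by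
    simp
  have memXA : ∀ (X Y : Set (ZMod (2 * n))) i, xa i ∈ a '' X ∪ xa '' Y ↔ i ∈ Y := fun X Y i => by
    simp
  have hA : ∀ i j : ZMod (2 * n),
      (-(cosetReflection hh j - cosetReflection hh i) ∈ M ∨
        ZMod.castHom hh2 (ZMod (2 * h)) (cosetReflection hh j - cosetReflection hh i) ∈ W) ↔
      (j - i ∈ M ∨ ZMod.castHom hh2 (ZMod (2 * h)) (j - i) ∈ W) := by
    intro i j
    refine or_congr ?_ ?_
    · by_cases hij : ZMod.castHom hh (ZMod h) (j - i) = 0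
      · rw [cosetReflection_sub hh hij, neg_neg]
      · refine iff_of_false (fun hmem => hij ?_) fun hmem => hij (hM _ hmem)
        have := hM _ hmem
        rwa [map_neg, neg_eq_zero, map_sub, castHom_cosetReflection, castHom_cosetReflection,
          ← map_sub] at this
    · rw [map_sub, castHom_two_mul_cosetReflection, castHom_two_mul_cosetReflection, ← map_sub]
  let φ : QuaternionGroup n → QuaternionGroup n
    | a i => a (cosetReflection hh i)
    | xa i => xa (cosetReflection hh i)
  have hφ : Function.Involutive φ := by
    rintro (i | i)
    · exact congrArg a (cosetReflection_involutive hh i)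
    · exact congrArg xa (cosetReflection_involutive hh i)
  refine DigraphIsomorphic.of_mul_inv_mem φ hφ.bijective ?_
  rintro (i | i) (j | j)
  · simp only [φ, inv_a, a_mul_a, memA, Set.mem_ofPred_eq, ← sub_eq_add_neg]
    exact hA i j
  · simp only [φ, inv_a, xa_mul_a, memXA, Set.mem_ofPred_eq, map_add, map_neg,
      castHom_two_mul_cosetReflection]
  · simp only [φ, inv_xa, a_mul_xa, memXA, Set.mem_ofPred_eq, map_add, map_sub,
      castHom_two_mul_cosetReflection]
  · have hd : ∀ x y : ZMod (2 * n), (n : ZMod (2 * n)) + (n + x) - y = x - y := fun x y => by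
      linear_combination hn2
    simp only [φ, inv_xa, xa_mul_xa, memA, Set.mem_ofPred_eq, hd]
    exact hA j i

theorem not_hasDCIProperty_of_prime_sq_dvd (hn : 3 ≤ n) (hodd : Odd n) {p m : ℕ} (hp : p.Prime)
    (hpm : p ≤ m - 1) (hm : m ≤ 2 * n - 1) (hpn : p ^ 2 ∣ n) :
    ¬ HasDCIProperty (QuaternionGroup n) m := by
  intro hDCI
  have : NeZero n := ⟨by omega⟩
  obtain ⟨d, hd⟩ := hpn
  have hp2 : ¬ p ∣ 2 := by
    intro h2
    rw [(Nat.prime_dvd_prime_iff_eq hp Nat.prime_two).1 h2] at hd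
    exact Nat.not_even_iff_odd.2 hodd ⟨2 * d, by rw [hd]; ring⟩
  have hp0 : 0 < p := hp.pos
  have hd0 : 0 < d := Nat.pos_of_ne_zero fun h0 => by simp [h0] at hd; omega
  obtain ⟨h, hh⟩ : ∃ h, h = p * d := ⟨_, rfl⟩
  have hh0 : 0 < h := hh ▸ Nat.mul_pos hp0 hd0
  have : NeZero h := ⟨hh0.ne'⟩
  have hnp : 2 * n = 2 * h * p := by rw [hd, hh]; ring
  have hdvd2 : 2 * h ∣ 2 * n := ⟨p, hnp⟩
  have hdvd : h ∣ 2 * n := (Dvd.intro_left 2 rfl).trans hdvd2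
  have hparN : residueParity (n : ZMod (2 * n)) = 1 := by
    rw [map_natCast]
    exact ZMod.natCast_eq_one_iff_odd.2 hodd
  have hpar2 : ∀ x : ℕ, residueParity ((2 * x : ℕ) : ZMod (2 * n)) = 0 := fun x => by
    rw [map_natCast]
    exact ZMod.natCast_eq_zero_iff_even.2 (even_two_mul x)
  have h10 : (1 : ZMod 2) ≠ 0 := by decide
  -- `a q` has order `p` and `a w` has order `p ^ 2`, with `p * w = q`
  set q : ZMod (2 * n) := ((2 * h : ℕ) : ZMod (2 * n)) with hq
  set w : ZMod (2 * n) := ((2 * d : ℕ) : ZMod (2 * n)) with hw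
  have hpw : (p : ZMod (2 * n)) * w = q := by
    rw [hw, hq, hh]
    push_cast
    ring
  have hpq : (p : ZMod (2 * n)) * q = 0 := by
    rw [hq, ← Nat.cast_mul, mul_comm p, ← hnp, ZMod.natCast_self]
  have hq2 : q + q ≠ 0 := by
    rw [hq, ← Nat.cast_add, ← mul_two, Ne, ZMod.natCast_eq_zero_iff, hnp]
    exact fun hdiv => hp2 (Nat.dvd_of_mul_dvd_mul_left (by omega) hdiv)
  set π := ZMod.castHom hdvd2 (ZMod (2 * h)) with hπ
  have hπq : π q = 0 := by rw [hq, map_natCast, ZMod.natCast_self]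
  have hπw : π w ≠ 0 := by
    rw [hw, map_natCast, Ne, ZMod.natCast_eq_zero_iff, hh, mul_left_comm]
    intro hdiv
    have := Nat.le_of_dvd (by omega) hdiv
    have := Nat.mul_le_mul_right (2 * d) hp.two_le
    omega
  have hρπ : ∀ x y, π x = π y → ZMod.castHom hdvd (ZMod h) x = ZMod.castHom hdvd (ZMod h) y := by
    intro x y hxy
    have hcomp : ZMod.castHom hdvd (ZMod h) =
        (ZMod.castHom (Dvd.intro_left 2 rfl) (ZMod h)).comp π := RingHom.ext_zmod _ _
    rw [hcomp, RingHom.comp_apply, RingHom.comp_apply, hxy]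
  have hρw : ZMod.castHom hdvd (ZMod h) w ≠ 0 := by
    rw [hw, map_natCast, Ne, ZMod.natCast_eq_zero_iff, hh]
    exact fun hdiv => hp2 (Nat.dvd_of_mul_dvd_mul_right hd0 hdiv)
  set r := (m - 1) % p with hr
  set k := (m - 1) / p with hk
  have hmkr : p * k + r = m - 1 := Nat.div_add_mod _ _
  have hrp : r < p := Nat.mod_lt _ hp0
  have hk1 : 1 ≤ k := Nat.div_pos hpm hp0
  have hkh : k ≤ 2 * h := by
    refine Nat.le_of_mul_le_mul_left ?_ hp0
    rw [mul_comm p (2 * h), ← hnp]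
    omega
  -- the odd elements `n + q * j` adjust the residue of `|S|` modulo `p`
  set M₁ : Finset (ZMod (2 * n)) :=
    (Finset.range r).image fun j : ℕ => ((n + 2 * h * j : ℕ) : ZMod (2 * n)) with hM₁
  have hM₁par : ∀ x ∈ M₁, residueParity x = 1 := by
    intro x hx
    obtain ⟨j, _, rfl⟩ := Finset.mem_image.1 hx
    rw [Nat.cast_add, map_add, hparN, mul_assoc, hpar2, add_zero]
  have hM₁card : M₁.card = r := by
    rw [hM₁, Finset.card_image_of_injOn, Finset.card_range]
    intro j hj j' hj' hjj'
    rw [Finset.coe_range, Set.mem_Iio] at hj hj'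
    have hmod := Nat.ModEq.add_left_cancel' n ((ZMod.natCast_eq_natCast_iff _ _ _).1 hjj')
    rw [hnp] at hmod
    have := Nat.ModEq.mul_left_cancel' (by omega) hmod
    exact Nat.ModEq.eq_of_lt_of_lt this (by omega) (by omega)
  have hqM₁ : q ∉ M₁ := fun hmem => h10 ((hM₁par q hmem).symm.trans (hpar2 h))
  have hMcard : (insert q M₁).card = r + 1 := by rw [Finset.card_insert_of_notMem hqM₁, hM₁card]
  have hMker : ∀ x ∈ insert q M₁, ZMod.castHom hdvd (ZMod h) x = 0 := by
    intro x hx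
    rcases Finset.mem_insert.1 hx with rfl | hx
    · rw [hq, map_natCast, ZMod.natCast_eq_zero_iff]
      exact Dvd.intro_left 2 rfl
    · obtain ⟨j, _, rfl⟩ := Finset.mem_image.1 hx
      rw [map_natCast, ZMod.natCast_eq_zero_iff]
      exact dvd_add ⟨p, by rw [hd, hh]; ring⟩ ⟨2 * j, by ring⟩
  obtain ⟨Y₀, -, hY₀⟩ := Finset.exists_subset_card_eq
    (s := (Finset.univ : Finset (ZMod (2 * h)))) (n := k - 1) (by
      rw [Finset.card_univ, ZMod.card]
      omega)
  have hfib : ∀ V : Finset (ZMod (2 * h)), (Finset.univ.filter fun x => π x ∈ V).card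
      = p * V.card := by
    intro V
    have := card_filter_mem_mul_card π.toAddMonoidHom (ZMod.castHom_surjective hdvd2) V
    rw [ZMod.card, ZMod.card] at this
    refine Nat.eq_of_mul_eq_mul_right (by omega : 0 < 2 * h) (this.trans ?_)
    rw [hnp]
    ring
  set X := insert q M₁ ∪ Finset.univ.filter fun x => π x ∈ ({π w} : Finset (ZMod (2 * h))) with hX
  set Y := Finset.univ.filter fun x => π x ∈ Y₀ with hY
  have hXcard : X.card = r + 1 + p := by
    rw [hX, Finset.card_union_of_disjoint, hMcard, hfib, Finset.card_singleton, mul_one]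
    rw [Finset.disjoint_left]
    intro x hx hx'
    rw [Finset.mem_filter, Finset.mem_singleton] at hx'
    exact hρw (by rw [← hρπ _ _ hx'.2, hMker x hx])
  have hcard : X.card + Y.card = m := by
    rw [hXcard, hY, hfib, hY₀]
    have : p * k = p + p * (k - 1) := by
      conv_lhs => rw [← Nat.sub_add_cancel hk1, mul_add, mul_one, add_comm]
    omega
  have hSX : (X : Set (ZMod (2 * n))) =
      {i | i ∈ ((insert q M₁ : Finset (ZMod (2 * n))) : Set (ZMod (2 * n))) ∨
        π i ∈ ({π w} : Set (ZMod (2 * h)))} := by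
    ext i
    simp [hX, or_assoc]
  have hSY : (Y : Set (ZMod (2 * n))) = {i | π i ∈ (Y₀ : Set (ZMod (2 * h)))} := by
    ext i
    simp [hY]
  -- `X` holds `q`, `M₁` and the class of `w`; the reflection turns `q` into `-q` and fixes the class
  have hiso := digraphIsomorphic_cosetReflection hdvd hdvd2
    (M := ((insert q M₁ : Finset (ZMod (2 * n))) : Set (ZMod (2 * n)))) hMker {π w} Y₀
  rw [← hπ, ← hSX, ← hSY] at hiso
  have h0M : (0 : ZMod (2 * n)) ∉ insert q M₁ := by
    rw [Finset.mem_insert, not_or]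
    exact ⟨fun h0 => hq2 (by rw [← h0, add_zero]),
      fun h0 => h10 ((hM₁par 0 h0).symm.trans (map_zero _))⟩
  have h1S : (1 : QuaternionGroup n) ∉ a '' (X : Set (ZMod (2 * n))) ∪ xa '' Y := by
    rw [hSX, one_def]
    rintro (⟨i, hi, hi0⟩ | ⟨i, -, hi0⟩)
    · rw [a.inj hi0] at hi
      rcases hi with hi | hi
      · exact h0M hi
      · exact hπw (Eq.symm ((map_zero π).symm.trans hi))
    · cases hi0
  have h1T : (1 : QuaternionGroup n) ∉ a '' {i : ZMod (2 * n) |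
      -i ∈ ((insert q M₁ : Finset (ZMod (2 * n))) : Set (ZMod (2 * n))) ∨
        π i ∈ ({π w} : Set (ZMod (2 * h)))} ∪ xa '' (Y : Set (ZMod (2 * n))) := by
    rw [one_def]
    rintro (⟨i, hi, hi0⟩ | ⟨i, -, hi0⟩)
    · rw [a.inj hi0] at hi
      rcases hi with hi | hi
      · rw [neg_zero] at hi
        exact h0M hi
      · exact hπw (Eq.symm ((map_zero π).symm.trans hi))
    · cases hi0
  obtain ⟨σ, hσ⟩ := (hDCI _ h1S
    (by rw [encard_image_a_union_image_xa, hcard])).2 _ h1T hiso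
  obtain ⟨t, ht⟩ := exists_mulEquiv_apply_a hn σ
  have himage : ∀ i ∈ X, -(t * i) ∈ insert q M₁ ∨ π (t * i) = π w := by
    intro i hi
    have hmem : σ (a i) ∈ σ '' (a '' (X : Set (ZMod (2 * n))) ∪ xa '' Y) :=
      ⟨_, Or.inl ⟨i, hi, rfl⟩, rfl⟩
    rw [hσ, ht] at hmem
    rcases hmem with ⟨j, hj, hji⟩ | ⟨j, -, hji⟩
    · rw [a.inj hji] at hj
      exact hj
    · cases hji
  have hevenM : ∀ x : ℕ, -(t * ((2 * x : ℕ) : ZMod (2 * n))) ∈ insert q M₁ →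
      -(t * ((2 * x : ℕ) : ZMod (2 * n))) = q := by
    intro x hx
    refine (Finset.mem_insert.1 hx).resolve_right fun hx' => h10 ?_
    rw [← hM₁par _ hx', map_neg, map_mul, hpar2, mul_zero, neg_zero]
  -- `a q` must go to `a (-q)`, so that `t = -1` modulo `p`, whereas the class of `w` is preserved,
  -- so that `t = 1` modulo `p`
  have htq : -(t * q) = q := by
    rcases himage q (by simp [hX]) with hmem | hmem
    · exact hevenM h hmem
    · rw [map_mul, hπq, mul_zero] at hmem
      exact absurd hmem.symm hπw
  rcases himage w (by simp [hX]) with hmem | hmem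
  · have htw := hevenM d hmem
    refine hq2 ?_
    have hq0 : q = 0 := by
      linear_combination (p : ZMod (2 * n)) * htw + t * hpw - htq + hpq
    rw [hq0, add_zero]
  · obtain ⟨l, hl⟩ := exists_eq_mul_of_castHom_eq_zero hdvd2 (y := t * w - w)
      (by rw [map_sub, sub_eq_zero]; exact hmem)
    rw [← hq] at hl
    refine hq2 ?_
    linear_combination -(p : ZMod (2 * n)) * hl + (t - 1) * hpw - l * hpq - htq

end PrimeSquare

end QuaternionGroup

open QuaternionGroup in
theorem theorem1p1 (n m : ℕ) (hn : 3 ≤ n) (hm₁ : 1 ≤ m) (hm₂ : m ≤ 2 * n - 1)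
    (h : HasDCIProperty (QuaternionGroup n) m) :
    Odd n ∧ ∀ p : ℕ, p.Prime → p ≤ m - 1 → ¬ p ^ 2 ∣ n := by
  have hodd : Odd n := by
    rw [← Nat.not_even_iff_odd, even_iff_two_dvd]
    rintro ⟨N, rfl⟩
    rcases Nat.even_or_odd N with hN | hN
    · exact not_hasDCIProperty_of_even_half hN (by omega) hm₁ hm₂ h
    · obtain ⟨k, hk⟩ := hN
      exact not_hasDCIProperty_of_odd_half ⟨k, hk⟩ (by omega) hm₁ hm₂ h
  exact ⟨hodd, fun p hp hpm hpn => not_hasDCIProperty_of_prime_sq_dvd hn hodd hp hpm hm₂ hpn h⟩
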